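/- Let $\varphi:\mathbb{R}^2\to\mathbb{R}$ be a smooth radial function supported in $\{\frac12\le|\xi|\le 2\}$ with $\sum_{j\in\mathbb{Z}}\varphi(2^{-j}\xi)=1$ for all $\xi\neq0$. For $g\in C_c^\infty(\mathbb{R}^2)$ (complex-valued) put $\hat g(\xi)=(2\pi)^{-2}\int_{\mathbb{R}^2}e^{-ix\cdot\xi}g(x)\,dx$, so that $g(x)=\int_{\mathbb{R}^2}e^{ix\cdot\xi}\hat g(\xi)\,d\xi$, and let $$e^{L_1t}g(x)=\int_{\mathbb{R}^2}e^{ix\cdot\xi-it\frac{\xi_1}{|\xi|^2}}\,\hat g(\xi)\,d\xi .$$ Let $P_j$, $j\in\mathbb{Z}$, be the Littlewood-Paley projectors $\widehat{P_jg}(\xi)=\varphi(2^{-j}\xi)\hat g(\xi)$, and let $\|g\|_{\dot B^3_{1,1}}=\sum_{j\in\mathbb{Z}}2^{3j}\|P_jg\|_{L^1}$. Then there is a constant $C>0$, depending only on $\varphi$, such that for every $g\in C_c^\infty(\mathbb{R}^2)$ and every $t>0$ $$\|e^{L_1t}g\|_{L^\infty}\le C\,t^{-1}\,\|g\|_{\dot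 B^3_{1,1}} .$$ -/

import Mathlib

open MeasureTheory
open scoped ENNReal ContDiff

namespace BetaPlane

/-- The Euclidean plane `ℝ²`. -/
abbrev Plane : Type := EuclideanSpace ℝ (Fin 2)

/-- The Fourier transform, normalised as
`ĝ(ξ) = (2π)⁻² ∫ e^{-i x·ξ} g(x) dx`, so that `g(x) = ∫ e^{i x·ξ} ĝ(ξ) dξ`. -/
noncomputable def fourierHat (g : Plane → ℂ) (ξ : Plane) : ℂ :=
  (((2 * Real.pi) ^ 2)⁻¹ : ℂ) *
    ∫ x : Plane, Complex.exp (-Complex.I * ((inner ℝ x ξ : ℝ) : ℂ)) * g x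

/-- The inverse Fourier transform belonging to `fourierHat`:
`h ↦ (x ↦ ∫ e^{i x·ξ} h(ξ) dξ)`. -/
noncomputable def fourierInv (h : Plane → ℂ) (x : Plane) : ℂ :=
  ∫ ξ : Plane, Complex.exp (Complex.I * ((inner ℝ x ξ : ℝ) : ℂ)) * h ξ

/-- The linear semigroup
`(e^{L₁ t} g)(x) = ∫ e^{i x·ξ - i t ξ₁ / |ξ|²} ĝ(ξ) dξ`.
The value of the phase at the single point `ξ = 0` is irrelevant. -/
noncomputable def semigroup (t : ℝ) (g : Plane → ℂ) (x : Plane) : ℂ :=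
  ∫ ξ : Plane,
    Complex.exp (Complex.I * ((inner ℝ x ξ : ℝ) : ℂ)
      - Complex.I * ((t * (ξ 0 / ‖ξ‖ ^ 2) : ℝ) : ℂ)) * fourierHat g ξ

/-- A Littlewood-Paley bump function on `ℝ²`: a smooth radial function supported in the shell
`1/2 ≤ |ξ| ≤ 2` whose dyadic rescalings form a partition of unity away from the origin. -/
structure IsLittlewoodPaleyBump (φ : Plane → ℝ) : Prop where
  smooth : ContDiff ℝ ∞ φ
  radial : ∀ ξ η : Plane, ‖ξ‖ = ‖η‖ → φ ξ = φ η
  support_subset : Function.support φ ⊆ {ξ : Plane | 1 / 2 ≤ ‖ξ‖ ∧ ‖ξ‖ ≤ 2}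
  hasSum_one : ∀ ξ : Plane, ξ ≠ 0 → HasSum (fun j : ℤ => φ ((2 : ℝ) ^ (-j) • ξ)) 1

/-- The Littlewood-Paley projector `P_j`: `(P_j g)^(ξ) = φ(2^{-j} ξ) ĝ(ξ)`. -/
noncomputable def lpProj (φ : Plane → ℝ) (j : ℤ) (g : Plane → ℂ) : Plane → ℂ :=
  fourierInv fun ξ => ((φ ((2 : ℝ) ^ (-j) • ξ) : ℝ) : ℂ) * fourierHat g ξ

/-- The homogeneous Besov norm `‖ (2^{s j} ‖P_j g‖_{L^p})_{j ∈ ℤ} ‖_{ℓ^q}`, with values in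
`[0, ∞]`; the `ℓ^q` norm is the `L^q` norm for the counting measure on `ℤ`. -/
noncomputable def besovNorm (φ : Plane → ℝ) (s : ℝ) (p q : ℝ≥0∞) (g : Plane → ℂ) : ℝ≥0∞ :=
  eLpNorm (fun j : ℤ => (2 : ℝ≥0∞) ^ (s * (j : ℝ)) * eLpNorm (lpProj φ j g) p volume)
    q Measure.count

end BetaPlane

/-! Littlewood-Paley decomposition reduces the claim to one kernel estimate: a multiplier `wave t x`
cut off to `|ξ| ~ 2^j` has kernel `O(t⁻¹ 2^{3j})`, uniformly in `x`. Fourier duality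
(`norm_integral_mul_le`) then bounds each dyadic piece by that supremum times `‖P_j g‖_{L¹}`, and
summing over `j` produces the Besov norm.

For the kernel, identify `ℝ²` with `ℂ`. Since `ξ₁/|ξ|² = Re (1/ξ)`, the phase is the real part of a
holomorphic function. Rescaling by `R = 2^{-j}` turns it into `s Re (w z - 1/z)` on a fixed shell,
with `s = t R` and `w` an arbitrary complex parameter carrying `x`. A bound `C/s` uniform in `w`
gives `R⁻² (t R)⁻¹ = t⁻¹ 2^{3j}`.

That bound is `exists_norm_integral_osc_le`. With `p = w + z⁻²` and `r = (1 + s|p|²)⁻¹`, the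
operator `r (1 - 2i p̄ ∂)` fixes the oscillating factor. One transposition leaves a term of size
`r`, whose integral loses a logarithm; two leave `O(r² + s⁻¹)` (`norm_amplitude_le`). As `|p|`
controls the distance to one of at most two critical points (`exists_min_dist_le_phaseDeriv`), `r²`
is dominated by bumps of width `s^{-1/2}`, of integral `O(s⁻¹)` in the plane. -/

namespace BetaPlane

/-! ### Calculus of the Wirtinger derivative. -/

/-- `h` is real differentiable at `z` with Wirtinger derivative `∂h = (∂₁h - i ∂₂h) / 2 = d`. -/
def HasDz (h : ℂ → ℂ) (d z : ℂ) : Prop :=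
  ∃ L : ℂ →L[ℝ] ℂ, HasFDerivAt h L z ∧ (L 1 - Complex.I * L Complex.I) / 2 = d

/-- The Wirtinger derivative `∂h = (∂₁h - i ∂₂h) / 2`. -/
noncomputable def dz (h : ℂ → ℂ) (z : ℂ) : ℂ :=
  (fderiv ℝ h z 1 - Complex.I * fderiv ℝ h z Complex.I) / 2

namespace HasDz

variable {h k : ℂ → ℂ} {c d z : ℂ}

theorem dz_eq (H : HasDz h d z) : dz h z = d := by
  obtain ⟨L, hL, rfl⟩ := H
  rw [dz, hL.fderiv]

theorem congr_deriv (H : HasDz h d z) (e : d = c) : HasDz h c z := e ▸ H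

theorem add (H : HasDz h c z) (K : HasDz k d z) : HasDz (fun x => h x + k x) (c + d) z := by
  obtain ⟨L, hL, rfl⟩ := H
  obtain ⟨M, hM, rfl⟩ := K
  refine ⟨L + M, hL.add hM, ?_⟩
  simp only [add_apply]
  ring

theorem sub (H : HasDz h c z) (K : HasDz k d z) : HasDz (fun x => h x - k x) (c - d) z := by
  obtain ⟨L, hL, rfl⟩ := H
  obtain ⟨M, hM, rfl⟩ := K
  refine ⟨L - M, hL.sub hM, ?_⟩
  simp only [sub_apply]
  ring

theorem mul (H : HasDz h c z) (K : HasDz k d z) :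
    HasDz (fun x => h x * k x) (c * k z + h z * d) z := by
  obtain ⟨L, hL, rfl⟩ := H
  obtain ⟨M, hM, rfl⟩ := K
  refine ⟨h z • M + k z • L, hL.mul hM, ?_⟩
  simp only [add_apply, smul_apply, smul_eq_mul]
  ring

theorem of_hasDerivAt (H : HasDerivAt h d z) : HasDz h d z := by
  refine ⟨_, H.hasFDerivAt.restrictScalars ℝ, ?_⟩
  simp only [ContinuousLinearMap.coe_restrictScalars', ContinuousLinearMap.toSpanSingleton_apply,
    smul_eq_mul]
  linear_combination (-d / 2) * Complex.I_mul_I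

/-- Antiholomorphic factors are constants for `∂`. This is why the conjugate of the phase derivative
passes through the integrations by parts undifferentiated. -/
theorem conj_of_hasDerivAt (H : HasDerivAt h d z) :
    HasDz (fun x => (starRingEnd ℂ) (h x)) 0 z := by
  refine ⟨_, Complex.conjCLE.hasFDerivAt.comp z (H.hasFDerivAt.restrictScalars ℝ), ?_⟩
  simp only [ContinuousLinearMap.coe_comp, Function.comp_apply,
    ContinuousLinearMap.coe_restrictScalars', ContinuousLinearMap.toSpanSingleton_apply,
    smul_eq_mul, ContinuousLinearEquiv.coe_coe, Complex.conjCLE_apply, map_mul, Complex.conj_I,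
    map_one]
  linear_combination ((starRingEnd ℂ) d / 2) * Complex.I_mul_I

theorem const (c z : ℂ) : HasDz (fun _ => c) 0 z := of_hasDerivAt (hasDerivAt_const z c)

theorem const_mul (c : ℂ) (H : HasDz h d z) : HasDz (fun x => c * h x) (c * d) z :=
  ((const c z).mul H).congr_deriv (by ring)

theorem comp {G : ℂ → ℂ} {G' : ℂ} (H : HasDz h d z) (hG : HasDerivAt G G' (h z)) :
    HasDz (fun x => G (h x)) (G' * d) z := by
  obtain ⟨L, hL, rfl⟩ := H
  refine ⟨_, (hG.hasFDerivAt.restrictScalars ℝ).comp z hL, ?_⟩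
  simp only [ContinuousLinearMap.coe_comp, Function.comp_apply,
    ContinuousLinearMap.coe_restrictScalars', ContinuousLinearMap.toSpanSingleton_apply,
    smul_eq_mul]
  ring

end HasDz

theorem hasDz_dz {h : ℂ → ℂ} {z : ℂ} (H : DifferentiableAt ℝ h z) : HasDz h (dz h z) z :=
  ⟨_, H.hasFDerivAt, rfl⟩

theorem contDiff_dz {h : ℂ → ℂ} (H : ContDiff ℝ ∞ h) : ContDiff ℝ ∞ (dz h) := by
  have h1 : ContDiff ℝ ∞ (fderiv ℝ h) := H.fderiv_right (by simp)
  unfold dz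
  fun_prop

theorem dz_eq_zero_of_eventuallyEq {h : ℂ → ℂ} {z : ℂ} (H : h =ᶠ[nhds z] fun _ => 0) :
    dz h =ᶠ[nhds z] fun _ => 0 := by
  filter_upwards [H.fderiv (𝕜 := ℝ)] with y hy
  simp [dz, hy]

/-! ### Integrals of derivatives of compactly supported functions. -/

theorem integrable_fderiv_apply {h : ℂ → ℂ} (H : ContDiff ℝ 1 h) (Hc : HasCompactSupport h)
    (v : ℂ) : Integrable (fun z => fderiv ℝ h z v) := by
  refine Continuous.integrable_of_hasCompactSupport ?_ (Hc.fderiv_apply ℝ v)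
  have := H.continuous_fderiv (by simp)
  fun_prop

theorem integral_fderiv_apply_eq_zero {h : ℂ → ℂ} (H : ContDiff ℝ 1 h)
    (Hc : HasCompactSupport h) (v : ℂ) : ∫ z, fderiv ℝ h z v = 0 := by
  -- Integration by parts against the constant `1`.
  have key := integral_mul_fderiv_eq_neg_fderiv_mul_of_integrable (μ := (volume : Measure ℂ))
    (f := h) (g := fun _ => (1 : ℂ)) (v := v)
    (by simpa using integrable_fderiv_apply H Hc v) (by simp)
    (by simpa using H.continuous.integrable_of_hasCompactSupport Hc)
    (fun x _ => (H.differentiable (by simp)) x) (fun x _ => by fun_prop)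
  simpa using key.symm

theorem integrable_dz {h : ℂ → ℂ} (H : ContDiff ℝ 1 h) (Hc : HasCompactSupport h) :
    Integrable (dz h) :=
  ((integrable_fderiv_apply H Hc 1).sub
    ((integrable_fderiv_apply H Hc Complex.I).const_mul Complex.I)).div_const 2

theorem integral_dz_eq_zero {h : ℂ → ℂ} (H : ContDiff ℝ 1 h) (Hc : HasCompactSupport h) :
    ∫ z, dz h z = 0 := by
  unfold dz
  rw [integral_div, integral_sub (integrable_fderiv_apply H Hc 1)
    ((integrable_fderiv_apply H Hc Complex.I).const_mul Complex.I), integral_const_mul,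
    integral_fderiv_apply_eq_zero H Hc, integral_fderiv_apply_eq_zero H Hc]
  simp

/-! ### The phase, the weight and two integrations by parts. -/

/-- The derivative `w + z⁻²` of the complex phase `w z - z⁻¹`. -/
noncomputable def phaseDeriv (w z : ℂ) : ℂ := w + (z ^ 2)⁻¹

/-- The oscillating factor `exp (i s Re (w z - z⁻¹))`. -/
noncomputable def osc (s : ℝ) (w z : ℂ) : ℂ :=
  Complex.exp (Complex.I * ((s * (w * z - z⁻¹).re : ℝ) : ℂ))

/-- The regularising weight `(1 + s |w + z⁻²|²)⁻¹`. -/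
noncomputable def weight (s : ℝ) (w z : ℂ) : ℂ :=
  (1 + s * (phaseDeriv w z * (starRingEnd ℂ) (phaseDeriv w z)))⁻¹

/-- The transposed integration by parts operator `u ↦ r u + 2 i q ∂(r u)` applied to `χ`, where
`r` is the weight and `q` is the conjugate of the derivative of the phase. -/
noncomputable def ibpStep (χ : ℂ → ℂ) (s : ℝ) (w z : ℂ) : ℂ :=
  weight s w z * χ z
    + 2 * Complex.I * (starRingEnd ℂ) (phaseDeriv w z) * weight s w z * dz χ z
    - 2 * Complex.I * s * (starRingEnd ℂ) (phaseDeriv w z) ^ 2 * (-2 * (z ^ 3)⁻¹)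
      * weight s w z ^ 2 * χ z

/-- The function whose Wirtinger derivative is the boundary term of two integrations by parts. -/
noncomputable def ibpPrimitive (χ : ℂ → ℂ) (s : ℝ) (w z : ℂ) : ℂ :=
  osc s w z * (starRingEnd ℂ) (phaseDeriv w z) * weight s w z * (χ z + ibpStep χ s w z)

section Calculus

variable {s : ℝ} {w z : ℂ}

theorem hasDerivAt_phaseDeriv (hz : z ≠ 0) :
    HasDerivAt (phaseDeriv w) (-2 * (z ^ 3)⁻¹) z := by
  have h := ((hasDerivAt_pow 2 z).inv (pow_ne_zero 2 hz)).const_add w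
  refine h.congr_deriv ?_
  field_simp
  ring

theorem hasDerivAt_inv_pow_three (hz : z ≠ 0) :
    HasDerivAt (fun z : ℂ => -2 * (z ^ 3)⁻¹) (6 * (z ^ 4)⁻¹) z := by
  have h := ((hasDerivAt_pow 3 z).inv (pow_ne_zero 3 hz)).const_mul (-2)
  refine h.congr_deriv ?_
  field_simp
  ring

/-- Writing `Re f = (f + conj f) / 2`, the operator `∂` sees only the holomorphic half. -/
theorem hasDz_osc (hz : z ≠ 0) :
    HasDz (osc s w) (Complex.I * s / 2 * phaseDeriv w z * osc s w z) z := by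
  have h0 : HasDerivAt (fun z : ℂ => w * z - z⁻¹) (phaseDeriv w z) z := by
    refine (((hasDerivAt_id z).const_mul w).sub (hasDerivAt_inv hz)).congr_deriv ?_
    simp [phaseDeriv]
  have h1 : osc s w = fun z => Complex.exp (Complex.I * s / 2 *
      ((w * z - z⁻¹) + (starRingEnd ℂ) (w * z - z⁻¹))) := by
    funext z
    rw [osc, Complex.add_conj]
    push_cast
    ring_nf
  rw [h1]
  refine ((((HasDz.of_hasDerivAt h0).add (HasDz.conj_of_hasDerivAt h0)).const_mul
      (Complex.I * s / 2)).comp (Complex.hasDerivAt_exp _)).congr_deriv ?_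
  ring

theorem one_add_ne_zero (hs : 0 < s) (a : ℂ) : (1 : ℂ) + s * (a * (starRingEnd ℂ) a) ≠ 0 := by
  rw [Complex.mul_conj, Complex.normSq_eq_norm_sq]
  norm_cast
  positivity

theorem norm_weight (hs : 0 < s) : ‖weight s w z‖ = (1 + s * ‖phaseDeriv w z‖ ^ 2)⁻¹ := by
  have h0 : (0 : ℝ) ≤ 1 + s * ‖phaseDeriv w z‖ ^ 2 := by positivity
  rw [weight, norm_inv, Complex.mul_conj, Complex.normSq_eq_norm_sq]
  congr 1
  rw [← Complex.norm_of_nonneg h0]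
  push_cast
  rfl

theorem hasDz_conj_phaseDeriv (hz : z ≠ 0) :
    HasDz (fun z => (starRingEnd ℂ) (phaseDeriv w z)) 0 z :=
  HasDz.conj_of_hasDerivAt (hasDerivAt_phaseDeriv hz)

theorem hasDz_weight (hs : 0 < s) (hz : z ≠ 0) :
    HasDz (weight s w)
      (-s * (starRingEnd ℂ) (phaseDeriv w z) * (-2 * (z ^ 3)⁻¹) * weight s w z ^ 2) z := by
  have hne := one_add_ne_zero hs (phaseDeriv w z)
  have hW : HasDz (fun x => 1 + s * (phaseDeriv w x * (starRingEnd ℂ) (phaseDeriv w x))) _ z :=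
    (HasDz.const 1 z).add (((HasDz.of_hasDerivAt (hasDerivAt_phaseDeriv hz)).mul
      (hasDz_conj_phaseDeriv hz)).const_mul (s : ℂ))
  refine (hW.comp (hasDerivAt_inv hne)).congr_deriv ?_
  rw [weight, inv_pow]
  ring

/-- The amplitude left after two integrations by parts, as a polynomial in the weight `r`,
`q = conj p`, `p'`, `p''` and the first derivatives `x`, `x₁`, `x₂` of the cutoff. -/
noncomputable def amplitude (s r q p₁ p₂ x x₁ x₂ : ℂ) : ℂ :=
  r * (r * x + 2 * Complex.I * q * r * x₁ - 2 * Complex.I * s * q ^ 2 * p₁ * r ^ 2 * x)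
  + 2 * Complex.I * q * (2 * r * (-s * q * p₁ * r ^ 2) * x + r ^ 2 * x₁
    + 2 * Complex.I * q * (2 * r * (-s * q * p₁ * r ^ 2) * x₁ + r ^ 2 * x₂)
    - 2 * Complex.I * s * q ^ 2 * (p₂ * r ^ 3 * x + 3 * p₁ * r ^ 2 * (-s * q * p₁ * r ^ 2) * x
      + p₁ * r ^ 3 * x₁))

/-- With `T` the operator of `ibpStep` and `e` the oscillating factor, `e u + 2i ∂(e q r u) = e T
u`. Adding this for `u = χ` and `u = T χ` telescopes to `e T² χ`, and `amplitude` is `T² χ`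
expanded. -/
theorem osc_mul_add_dz_ibpPrimitive {χ : ℂ → ℂ} (hχ : ContDiff ℝ ∞ χ) (hs : 0 < s)
    (hz : z ≠ 0) :
    osc s w z * χ z + 2 * Complex.I * dz (ibpPrimitive χ s w) z =
      osc s w z * amplitude s (weight s w z) ((starRingEnd ℂ) (phaseDeriv w z))
        (-2 * (z ^ 3)⁻¹) (6 * (z ^ 4)⁻¹) (χ z) (dz χ z) (dz (dz χ) z) := by
  have hx : HasDz χ (dz χ z) z := hasDz_dz (hχ.differentiable (by simp) z)
  have hx1 : HasDz (dz χ) (dz (dz χ) z) z :=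
    hasDz_dz ((contDiff_dz hχ).differentiable (by simp) z)
  have hr := hasDz_weight (w := w) hs hz
  have hq := hasDz_conj_phaseDeriv (w := w) hz
  have hp1 := HasDz.of_hasDerivAt (hasDerivAt_inv_pow_three hz)
  have he := hasDz_osc (s := s) (w := w) hz
  have hpow : ∀ {h : ℂ → ℂ} {d : ℂ}, HasDz h d z → HasDz (fun x => h x ^ 2) (2 * h z * d) z := by
    intro h d H
    simpa only [sq] using (H.mul H).congr_deriv (c := 2 * h z * d) (by ring)
  have hT : HasDz (ibpStep χ s w) _ z :=
    ((hr.mul hx).add (((hq.const_mul (2 * Complex.I)).mul hr).mul hx1)).sub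
      (((((hpow hq).const_mul (2 * Complex.I * s)).mul hp1).mul (hpow hr)).mul hx)
  have hH : HasDz (ibpPrimitive χ s w) _ z := ((he.mul hq).mul hr).mul (hx.add hT)
  rw [hH.dz_eq]
  have hrel : weight s w z *
      (1 + s * (phaseDeriv w z * (starRingEnd ℂ) (phaseDeriv w z))) = 1 :=
    inv_mul_cancel₀ (one_add_ne_zero hs _)
  simp only [ibpStep, amplitude]
  generalize weight s w z = r at *
  generalize (starRingEnd ℂ) (phaseDeriv w z) = q at *
  generalize phaseDeriv w z = p at *
  generalize osc s w z = e at *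
  generalize χ z = x at *
  generalize dz χ z = x1 at *
  generalize dz (dz χ) z = x2 at *
  generalize (z ^ 3)⁻¹ = a at *
  generalize (z ^ 4)⁻¹ = b at *
  have hI := Complex.I_mul_I
  generalize Complex.I = i at *
  generalize (s : ℂ) = σ at *
  -- The derivative of `osc` brings `2i · (i s / 2) p q r = -s p q r`; `hrel` trades `s p q r` for
  -- `1 - r`.
  linear_combination
    (-(e * (x + (r * x + 2 * i * q * r * x1 - 2 * i * σ * q ^ 2 * (-2 * a) * r ^ 2 * x)))) * hrel
    + (σ * p * e * q * r * (x + (r * x + 2 * i * q * r * x1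
      - 2 * i * σ * q ^ 2 * (-2 * a) * r ^ 2 * x))) * hI

end Calculus

/-! ### Pointwise bounds: the amplitude, the critical points, the profile. -/

/-- Every factor `s` in the expansion is absorbed by `s |q|² |r| ≤ 1`. What remains is `|r|²` times
`1`, `|q|` or `|q|²`, and `|q|² |r|² ≤ s⁻¹`. -/
theorem norm_amplitude_le {s : ℝ} (hs : 0 < s) {r q p₁ p₂ x x₁ x₂ : ℂ} {A X : ℝ}
    (hr : ‖r‖ = (1 + s * ‖q‖ ^ 2)⁻¹) (hA : 1 ≤ A) (hp₁ : ‖p₁‖ ≤ A) (hp₂ : ‖p₂‖ ≤ A)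
    (hx : ‖x‖ ≤ X) (hx₁ : ‖x₁‖ ≤ X) (hx₂ : ‖x₂‖ ≤ X) :
    ‖amplitude s r q p₁ p₂ x x₁ x₂‖ ≤ 29 * (A ^ 2 * X) * (‖r‖ ^ 2 + s⁻¹) := by
  have e : amplitude s r q p₁ p₂ x x₁ x₂ = r ^ 2 * x + 4 * Complex.I * q * r ^ 2 * x₁
      + -6 * Complex.I * s * q ^ 2 * p₁ * r ^ 3 * x + 12 * s * q ^ 3 * p₁ * r ^ 3 * x₁
      + -4 * q ^ 2 * r ^ 2 * x₂ + 4 * s * q ^ 3 * p₂ * r ^ 3 * x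
      + -12 * s ^ 2 * q ^ 4 * p₁ ^ 2 * r ^ 4 * x := by
    rw [amplitude]
    linear_combination (-8 * q ^ 3 * r ^ 3 * s * p₁ * x₁ + 4 * q ^ 2 * r ^ 2 * x₂
      - 4 * s * q ^ 3 * p₂ * r ^ 3 * x + 12 * s ^ 2 * q ^ 4 * p₁ ^ 2 * r ^ 4 * x
      - 4 * s * q ^ 3 * p₁ * r ^ 3 * x₁) * Complex.I_mul_I
  have tri : ∀ a b c d e f g : ℂ, ‖a + b + c + d + e + f + g‖ ≤
      ‖a‖ + ‖b‖ + ‖c‖ + ‖d‖ + ‖e‖ + ‖f‖ + ‖g‖ := by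
    intro a b c d e f g
    iterate 6 refine (norm_add_le _ _).trans (add_le_add_left ?_ _)
    exact le_rfl
  rw [e]
  refine (tri _ _ _ _ _ _ _).trans ?_
  simp only [norm_mul, norm_pow, norm_neg, Complex.norm_I, Complex.norm_real, Complex.norm_ofNat,
    Real.norm_of_nonneg hs.le, mul_one]
  have hρ0 : 0 ≤ ‖r‖ := norm_nonneg r
  have ha : s * ‖q‖ ^ 2 * ‖r‖ ≤ 1 := by
    rw [hr, ← div_eq_mul_inv]
    exact (div_le_one (by positivity)).2 (by linarith)
  have hρ1 : ‖r‖ ≤ 1 := by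
    rw [hr]
    exact inv_le_one_of_one_le₀ (by nlinarith [sq_nonneg ‖q‖])
  have hmρ : ‖q‖ ^ 2 * ‖r‖ ^ 2 ≤ s⁻¹ := by
    rw [← one_div, le_div_iff₀ hs]
    nlinarith [mul_nonneg (mul_nonneg hs.le (sq_nonneg ‖q‖)) hρ0]
  have hX : 0 ≤ X := (norm_nonneg x).trans hx
  have hAX : X ≤ A ^ 2 * X := by nlinarith [mul_nonneg hX (sub_nonneg.2 hA)]
  have hm0 : 0 ≤ ‖q‖ := norm_nonneg q
  have hb0 : 0 ≤ s * ‖q‖ ^ 2 * ‖r‖ := by positivity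
  have hp1x : ∀ {y p : ℂ}, ‖y‖ ≤ X → ‖p‖ ≤ A → ‖p‖ * ‖y‖ ≤ A ^ 2 * X := by
    intro y p hy hp
    calc ‖p‖ * ‖y‖ ≤ A * X := by gcongr
      _ ≤ A ^ 2 * X := by
        gcongr
        nlinarith
  have hpx : ‖p₁‖ ^ 2 * ‖x‖ ≤ A ^ 2 * X := by gcongr
  have h1 := hp1x hx hp₁
  have h2 := hp1x hx₁ hp₁
  have h3 := hp1x hx hp₂
  generalize hY : A ^ 2 * X = Y at *
  have hY0 : 0 ≤ Y := hX.trans hAX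
  generalize ‖q‖ = m at *
  generalize ‖r‖ = ρ at *
  generalize hb : s * m ^ 2 * ρ = b at *
  have hb2 : b ^ 2 ≤ 1 := by nlinarith
  have hρ2 : 0 ≤ ρ ^ 2 := sq_nonneg ρ
  calc _ = ρ ^ 2 * ‖x‖ + 4 * (m * ρ ^ 2) * ‖x₁‖ + 6 * (b * ρ ^ 2) * (‖p₁‖ * ‖x‖)
        + 12 * (b * (m * ρ ^ 2)) * (‖p₁‖ * ‖x₁‖) + 4 * (m ^ 2 * ρ ^ 2) * ‖x₂‖
        + 4 * (b * (m * ρ ^ 2)) * (‖p₂‖ * ‖x‖) + 12 * (b ^ 2 * ρ ^ 2) * (‖p₁‖ ^ 2 * ‖x‖) := by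
        rw [← hb]; ring
    _ ≤ ρ ^ 2 * Y + 4 * (m * ρ ^ 2) * Y + 6 * (1 * ρ ^ 2) * Y
        + 12 * (1 * (m * ρ ^ 2)) * Y + 4 * (m ^ 2 * ρ ^ 2) * Y
        + 4 * (1 * (m * ρ ^ 2)) * Y + 12 * (1 * ρ ^ 2) * Y := by
        gcongr
        · exact hx.trans hAX
        · exact hx₁.trans hAX
        · exact hx₂.trans hAX
    _ = (19 * ρ ^ 2 + 20 * (m * ρ ^ 2) + 4 * (m ^ 2 * ρ ^ 2)) * Y := by ring
    -- `2m ≤ 1 + m²` splits the middle term: `29 = 19 + 10` and `14 = 4 + 10`.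
    _ ≤ (29 * ρ ^ 2 + 14 * (m ^ 2 * ρ ^ 2)) * Y := by
        gcongr ?_ * Y
        nlinarith [mul_nonneg hρ2 (sq_nonneg (m - 1))]
    _ ≤ (29 * ρ ^ 2 + 29 * s⁻¹) * Y := by
        gcongr ?_ * Y
        nlinarith [inv_pos.2 hs]
    _ = _ := by ring

/-- The derivative of the phase dominates the distance to one of two critical points. -/
theorem exists_min_dist_le_phaseDeriv (w : ℂ) : ∃ a b : ℂ, ∀ z : ℂ, 1 / 4 ≤ ‖z‖ → ‖z‖ ≤ 4 →
    ‖z - a‖ ≤ 128 * ‖phaseDeriv w z‖ ∨ ‖z - b‖ ≤ 128 * ‖phaseDeriv w z‖ := by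
  by_cases hw : ‖w‖ ≤ 1 / 32
  -- No critical point is near the shell: `|p| ≥ 1/16 - 1/32`, so `|z| ≤ 4 = 128/32` suffices and
  -- the origin is a dummy centre.
  · refine ⟨0, 0, fun z h1 h2 => Or.inl ?_⟩
    have h3 : ‖(z ^ 2)⁻¹‖ ≤ ‖phaseDeriv w z‖ + ‖w‖ := by
      have : (z ^ 2)⁻¹ = phaseDeriv w z - w := by simp [phaseDeriv]
      rw [this]
      exact norm_sub_le _ _
    have h4 : (1 / 16 : ℝ) ≤ ‖(z ^ 2)⁻¹‖ := by
      rw [norm_inv, norm_pow, ← one_div]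
      apply one_div_le_one_div_of_le <;> nlinarith
    rw [sub_zero]
    linarith
  · push Not at hw
    have hw0 : w ≠ 0 := by
      rintro rfl
      norm_num at hw
    obtain ⟨c, hc⟩ := IsAlgClosed.exists_pow_nat_eq (-w⁻¹) (n := 2) two_pos
    have hc0 : c ≠ 0 := by
      rintro rfl
      simp [hw0] at hc
    have hcn : ‖c‖ < 6 := by
      have h5 : ‖c‖ ^ 2 = ‖w‖⁻¹ := by rw [← norm_pow, hc, norm_neg, norm_inv]
      have h6 : ‖w‖⁻¹ < 32 := by
        rw [← one_div, div_lt_iff₀ (by linarith)]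
        linarith
      nlinarith [norm_nonneg c]
    have hwc : w = -(c ^ 2)⁻¹ := by rw [hc, inv_neg, inv_inv, neg_neg]
    refine ⟨c, -c, fun z h1 h2 => ?_⟩
    have hz : z ≠ 0 := norm_pos_iff.1 (by linarith)
    have hc1 : 0 < ‖c‖ := norm_pos_iff.2 hc0
    -- Here `p = z⁻² - c⁻²` vanishes at `±c`. The farther root is at distance at least `|c|`, so one
    -- factor `|c|` cancels.
    have key : ‖z - c‖ * ‖z - -c‖ = ‖phaseDeriv w z‖ * (‖z‖ ^ 2 * ‖c‖ ^ 2) := by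
      rw [← norm_mul, ← norm_pow, ← norm_pow, ← norm_mul, ← norm_mul, ← norm_neg]
      congr 1
      rw [phaseDeriv, hwc]
      field_simp
      ring
    have hsum : 2 * ‖c‖ ≤ ‖z - c‖ + ‖z - -c‖ := by
      have : (2 : ℂ) * c = (z - -c) - (z - c) := by ring
      calc 2 * ‖c‖ = ‖(z - -c) - (z - c)‖ := by rw [← this, norm_mul, Complex.norm_ofNat]
        _ ≤ _ := (norm_sub_le _ _).trans (by linarith)
    have hP : ‖phaseDeriv w z‖ * (‖z‖ ^ 2 * ‖c‖ ^ 2) ≤ 128 * ‖phaseDeriv w z‖ * ‖c‖ := by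
      -- `16 · 6 = 96`; the bound on `|c|` comes from `|w| > 1/32`.
      have h7 : ‖z‖ ^ 2 * ‖c‖ ≤ 128 := by nlinarith [norm_nonneg z]
      calc _ = ‖phaseDeriv w z‖ * ‖c‖ * (‖z‖ ^ 2 * ‖c‖) := by ring
        _ ≤ ‖phaseDeriv w z‖ * ‖c‖ * 128 := by gcongr
        _ = _ := by ring
    rcases le_total ‖z - c‖ ‖z - -c‖ with h | h
    · left
      have : ‖z - c‖ * ‖c‖ ≤ ‖z - c‖ * ‖z - -c‖ := by gcongr; linarith
      exact le_of_mul_le_mul_right (by linarith) hc1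
    · right
      have : ‖c‖ * ‖z - -c‖ ≤ ‖z - c‖ * ‖z - -c‖ := by gcongr; linarith
      exact le_of_mul_le_mul_right (by linarith) hc1

/-- The integrable profile `(1 + |y|²)⁻²`. -/
noncomputable def profile (y : ℂ) : ℝ := ((1 + ‖y‖ ^ 2) ^ 2)⁻¹

theorem profile_nonneg (y : ℂ) : 0 ≤ profile y := by
  unfold profile
  positivity

theorem integrable_profile : Integrable profile := by
  -- The exponent `r = 4` exceeds the real dimension `2` and gives the power `-r/2 = -2`.
  have h := integrable_rpow_neg_one_add_norm_sq (E := ℂ) (μ := volume) (r := 4)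
    (by rw [Complex.finrank_real_complex]; norm_num)
  refine h.congr (Filter.Eventually.of_forall fun y => ?_)
  have h0 : (0 : ℝ) ≤ 1 + ‖y‖ ^ 2 := by positivity
  have h1 : (-4 / 2 : ℝ) = -((2 : ℕ) : ℝ) := by norm_num
  simp only [profile]
  rw [h1, Real.rpow_neg h0, Real.rpow_natCast]

theorem integrable_profile_comp {R : ℝ} (hR : R ≠ 0) (a : ℂ) :
    Integrable (fun z => profile (R • (z - a))) :=
  (integrable_profile.comp_smul hR).comp_sub_right a

theorem integral_profile_comp {R : ℝ} (a : ℂ) :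
    ∫ z, profile (R • (z - a)) = (R ^ 2)⁻¹ * ∫ z, profile z := by
  rw [integral_sub_right_eq_self (fun z => profile (R • z)) a, Measure.integral_comp_smul,
    Complex.finrank_real_complex, abs_of_nonneg (by positivity), smul_eq_mul]

theorem norm_weight_sq_le_profile {s : ℝ} (hs : 0 < s) {w z a : ℂ}
    (h : ‖z - a‖ ≤ 128 * ‖phaseDeriv w z‖) :
    ‖weight s w z‖ ^ 2 ≤ profile ((√s / 128) • (z - a)) := by
  rw [norm_weight hs, profile, inv_pow]
  gcongr
  rw [norm_smul, mul_pow, Real.norm_of_nonneg (by positivity), div_pow, Real.sq_sqrt hs.le]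
  have : ‖z - a‖ ^ 2 ≤ (128 * ‖phaseDeriv w z‖) ^ 2 := by gcongr
  calc s / 128 ^ 2 * ‖z - a‖ ^ 2 ≤ s / 128 ^ 2 * (128 * ‖phaseDeriv w z‖) ^ 2 := by gcongr
    _ = _ := by ring

/-! ### Regularity on the shell and the uniform stationary phase bound. -/

section Cutoff

variable {χ : ℂ → ℂ} {s : ℝ} {w z : ℂ}

theorem eventuallyEq_zero_of_support (h : Function.support χ ⊆ {z | 1 / 4 ≤ ‖z‖ ∧ ‖z‖ ≤ 4})
    (hz : ¬(1 / 4 ≤ ‖z‖ ∧ ‖z‖ ≤ 4)) : χ =ᶠ[nhds z] fun _ => 0 := by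
  have hc : IsClosed {z : ℂ | 1 / 4 ≤ ‖z‖ ∧ ‖z‖ ≤ 4} :=
    (isClosed_le continuous_const continuous_norm).inter
      (isClosed_le continuous_norm continuous_const)
  filter_upwards [hc.isOpen_compl.mem_nhds hz] with y hy
  exact Function.notMem_support.1 fun h' => hy (h h')

theorem support_dz_subset (h : Function.support χ ⊆ {z | 1 / 4 ≤ ‖z‖ ∧ ‖z‖ ≤ 4}) :
    Function.support (dz χ) ⊆ {z | 1 / 4 ≤ ‖z‖ ∧ ‖z‖ ≤ 4} := by
  intro z hz
  by_contra hn
  exact hz (dz_eq_zero_of_eventuallyEq (eventuallyEq_zero_of_support h hn)).eq_of_nhds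

theorem hasCompactSupport_of_shell (h : Function.support χ ⊆ {z | 1 / 4 ≤ ‖z‖ ∧ ‖z‖ ≤ 4}) :
    HasCompactSupport χ := by
  refine HasCompactSupport.intro (isCompact_closedBall (0 : ℂ) 4) fun z hz => ?_
  by_contra hn
  exact hz (by simpa using (h hn).2)

/-- The factor `f` may be singular at the origin, because the cutoff vanishes in a neighbourhood of
it. -/
theorem contDiff_mul_of_shell (hχ : ContDiff ℝ ∞ χ)
    (h : Function.support χ ⊆ {z | 1 / 4 ≤ ‖z‖ ∧ ‖z‖ ≤ 4}) {f : ℂ → ℂ}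
    (hf : ∀ z ≠ 0, ContDiffAt ℝ 1 f z) : ContDiff ℝ 1 (fun z => f z * χ z) := by
  rw [contDiff_iff_contDiffAt]
  intro z
  by_cases hz : z = 0
  · have h0 : (fun z => f z * χ z) =ᶠ[nhds z] fun _ => 0 := by
      filter_upwards [eventuallyEq_zero_of_support h (z := z) (by norm_num [hz])] with y hy
      simp [hy]
    exact contDiffAt_const.congr_of_eventuallyEq h0
  · exact (hf z hz).mul ((hχ.contDiffAt).of_le (by exact_mod_cast le_top))

theorem contDiffAt_phaseDeriv (hz : z ≠ 0) : ContDiffAt ℝ 1 (phaseDeriv w) z := by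
  unfold phaseDeriv
  exact contDiffAt_const.add ((contDiffAt_id.pow 2).inv (pow_ne_zero 2 hz))

theorem contDiffAt_conj_phaseDeriv (hz : z ≠ 0) :
    ContDiffAt ℝ 1 (fun z => (starRingEnd ℂ) (phaseDeriv w z)) z :=
  Complex.conjCLE.contDiff.contDiffAt.comp z (contDiffAt_phaseDeriv hz)

theorem contDiffAt_weight (hs : 0 < s) (hz : z ≠ 0) : ContDiffAt ℝ 1 (weight s w) z := by
  unfold weight
  exact (contDiffAt_const.add (contDiffAt_const.mul ((contDiffAt_phaseDeriv hz).mul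
    (contDiffAt_conj_phaseDeriv hz)))).inv (one_add_ne_zero hs _)

theorem contDiffAt_osc (hz : z ≠ 0) : ContDiffAt ℝ 1 (osc s w) z := by
  unfold osc
  have h : ContDiffAt ℝ 1 (fun z : ℂ => w * z - z⁻¹) z :=
    (contDiffAt_const.mul contDiffAt_id).sub (contDiffAt_id.inv hz)
  have h1 : ContDiffAt ℝ 1 (fun z : ℂ => (s * (w * z - z⁻¹).re : ℝ)) z :=
    contDiffAt_const.mul (Complex.reCLM.contDiff.contDiffAt.comp z h)
  exact (contDiffAt_const.mul (Complex.ofRealCLM.contDiff.contDiffAt.comp z h1)).cexp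

theorem contDiff_ibpPrimitive (hχ : ContDiff ℝ ∞ χ)
    (h : Function.support χ ⊆ {z | 1 / 4 ≤ ‖z‖ ∧ ‖z‖ ≤ 4}) (hs : 0 < s) :
    ContDiff ℝ 1 (ibpPrimitive χ s w) := by
  -- Grouped by `χ` and `dz χ`, so that `contDiff_mul_of_shell` applies to each summand.
  have e : ibpPrimitive χ s w = fun z =>
      (osc s w z * (starRingEnd ℂ) (phaseDeriv w z) * weight s w z * (1 + weight s w z
        - 2 * Complex.I * s * (starRingEnd ℂ) (phaseDeriv w z) ^ 2 * (-2 * (z ^ 3)⁻¹)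
          * weight s w z ^ 2)) * χ z
      + (osc s w z * (starRingEnd ℂ) (phaseDeriv w z) * weight s w z * (2 * Complex.I
          * (starRingEnd ℂ) (phaseDeriv w z) * weight s w z)) * dz χ z := by
    funext z
    rw [ibpPrimitive, ibpStep]
    ring
  have hcub : ∀ z : ℂ, z ≠ 0 → ContDiffAt ℝ 1 (fun z : ℂ => -2 * (z ^ 3)⁻¹) z := fun z hz =>
    contDiffAt_const.mul ((contDiffAt_id.pow 3).inv (pow_ne_zero 3 hz))
  rw [e]
  refine (contDiff_mul_of_shell hχ h fun z hz => ?_).add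
    (contDiff_mul_of_shell (contDiff_dz hχ) (support_dz_subset h) fun z hz => ?_)
  · have h1 := contDiffAt_osc (s := s) (w := w) hz
    have h2 := contDiffAt_conj_phaseDeriv (w := w) hz
    have h3 := contDiffAt_weight (w := w) hs hz
    have h4 := hcub z hz
    exact ((h1.mul h2).mul h3).mul ((contDiffAt_const.add h3).sub
      (((contDiffAt_const.mul (h2.pow 2)).mul h4).mul (h3.pow 2)))
  · have h1 := contDiffAt_osc (s := s) (w := w) hz
    have h2 := contDiffAt_conj_phaseDeriv (w := w) hz
    have h3 := contDiffAt_weight (w := w) hs hz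
    exact ((h1.mul h2).mul h3).mul ((contDiffAt_const.mul h2).mul h3)

theorem ibpPrimitive_eq_zero (h : Function.support χ ⊆ {z | 1 / 4 ≤ ‖z‖ ∧ ‖z‖ ≤ 4})
    (hz : ¬(1 / 4 ≤ ‖z‖ ∧ ‖z‖ ≤ 4)) : ibpPrimitive χ s w z = 0 := by
  have h1 : χ z = 0 := Function.notMem_support.1 fun h' => hz (h h')
  have h2 : dz χ z = 0 := Function.notMem_support.1 fun h' => hz (support_dz_subset h h')
  simp [ibpPrimitive, ibpStep, h1, h2]

theorem norm_osc : ‖osc s w z‖ = 1 := by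
  rw [osc, mul_comm, Complex.norm_exp_ofReal_mul_I]

theorem exists_norm_le_of_shell (hχ : ContDiff ℝ ∞ χ)
    (h : Function.support χ ⊆ {z | 1 / 4 ≤ ‖z‖ ∧ ‖z‖ ≤ 4}) :
    ∃ X : ℝ, ∀ z, ‖χ z‖ ≤ X ∧ ‖dz χ z‖ ≤ X ∧ ‖dz (dz χ) z‖ ≤ X := by
  have h1 := support_dz_subset h
  have h2 := support_dz_subset h1
  have c1 := contDiff_dz hχ
  have c2 := contDiff_dz c1
  obtain ⟨A, hA⟩ := (hasCompactSupport_of_shell h).exists_bound_of_continuous hχ.continuous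
  obtain ⟨B, hB⟩ := (hasCompactSupport_of_shell h1).exists_bound_of_continuous c1.continuous
  obtain ⟨C, hC⟩ := (hasCompactSupport_of_shell h2).exists_bound_of_continuous c2.continuous
  exact ⟨max A (max B C), fun z => ⟨(hA z).trans (by simp), (hB z).trans (by simp),
    (hC z).trans (by simp)⟩⟩

/-- Stationary phase bound, uniform in the linear part `w` of the phase. -/
theorem exists_norm_integral_osc_le (hχ : ContDiff ℝ ∞ χ)
    (h : Function.support χ ⊆ {z | 1 / 4 ≤ ‖z‖ ∧ ‖z‖ ≤ 4}) :
    ∃ C : ℝ, 0 < C ∧ ∀ s : ℝ, 0 < s → ∀ w : ℂ, ‖∫ z, osc s w z * χ z‖ ≤ C * s⁻¹ := by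
  obtain ⟨X, hX⟩ := exists_norm_le_of_shell hχ h
  have hX0 : 0 ≤ X := (norm_nonneg _).trans (hX 0).1
  set K : ℝ := 29 * (1536 ^ 2 * X) with hK
  have hK0 : 0 ≤ K := by positivity
  set V : ℝ := (volume : Measure ℂ).real (Metric.closedBall 0 4)
  set Q : ℝ := ∫ z, profile z
  have hQ0 : 0 ≤ Q := integral_nonneg profile_nonneg
  -- The summand `1` only keeps the constant positive, since `K` may vanish.
  refine ⟨K * (2 * 128 ^ 2 * Q + V) + 1, by positivity, fun s hs w => ?_⟩
  obtain ⟨a, b, hab⟩ := exists_min_dist_le_phaseDeriv w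
  have hR : √s / 128 ≠ 0 := by positivity
  have hR2 : ((√s / 128) ^ 2)⁻¹ = 128 ^ 2 * s⁻¹ := by
    rw [div_pow, Real.sq_sqrt hs.le, inv_div, div_eq_mul_inv]
  -- Both profiles are summed because the nearer critical point depends on `z`.
  let G : ℂ → ℝ := fun z => K * (profile ((√s / 128) • (z - a))
    + profile ((√s / 128) • (z - b))
    + (Metric.closedBall (0 : ℂ) 4).indicator (fun _ => s⁻¹) z)
  have hi : Integrable ((Metric.closedBall (0 : ℂ) 4).indicator fun _ => s⁻¹) :=
    (integrable_indicator_iff Metric.isClosed_closedBall.measurableSet).2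
      (integrableOn_const (by exact (isCompact_closedBall (0 : ℂ) 4).measure_lt_top.ne))
  have hab_i : Integrable fun z => profile ((√s / 128) • (z - a))
      + profile ((√s / 128) • (z - b)) :=
    (integrable_profile_comp hR a).add (integrable_profile_comp hR b)
  have hGi : Integrable G := (hab_i.add hi).const_mul K
  have hHd := contDiff_ibpPrimitive (w := w) hχ h hs
  have hHc : HasCompactSupport (ibpPrimitive χ s w) :=
    hasCompactSupport_of_shell fun z hz => by
      by_contra hn
      exact hz (ibpPrimitive_eq_zero h hn)
  have hoi : Integrable (fun z => osc s w z * χ z) :=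
    (contDiff_mul_of_shell hχ h fun z hz => contDiffAt_osc hz).continuous
      |>.integrable_of_hasCompactSupport (hasCompactSupport_of_shell h).mul_left
  have heq : ∫ z, osc s w z * χ z =
      ∫ z, (osc s w z * χ z + 2 * Complex.I * dz (ibpPrimitive χ s w) z) := by
    rw [integral_add hoi ((integrable_dz hHd hHc).const_mul _), integral_const_mul,
      integral_dz_eq_zero hHd hHc]
    simp
  have hbound : ∀ z, z ≠ 0 →
      ‖osc s w z * χ z + 2 * Complex.I * dz (ibpPrimitive χ s w) z‖ ≤ G z := by
    intro z hz
    rw [osc_mul_add_dz_ibpPrimitive hχ hs hz, norm_mul, norm_osc, one_mul]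
    by_cases hsh : 1 / 4 ≤ ‖z‖ ∧ ‖z‖ ≤ 4
    · have hinv : ‖z‖⁻¹ ≤ 4 := by
        rw [← one_div, div_le_iff₀ (by linarith)]
        linarith
      have hrn : ‖weight s w z‖ = (1 + s * ‖(starRingEnd ℂ) (phaseDeriv w z)‖ ^ 2)⁻¹ := by
        rw [norm_weight hs, Complex.norm_conj]
      -- `1536 = 6 · 4⁴` bounds the second derivative of `p` where `|z| ≥ 1/4`; the first is at most
      -- `2 · 4³`.
      refine (norm_amplitude_le hs (A := 1536) hrn (by norm_num) ?_ ?_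
        (hX z).1 (hX z).2.1 (hX z).2.2).trans ?_
      · rw [norm_mul, norm_inv, norm_pow, ← inv_pow, norm_neg, Complex.norm_ofNat]
        calc 2 * ‖z‖⁻¹ ^ 3 ≤ 2 * 4 ^ 3 := by gcongr
          _ ≤ 1536 := by norm_num
      · rw [norm_mul, norm_inv, norm_pow, ← inv_pow, Complex.norm_ofNat]
        calc 6 * ‖z‖⁻¹ ^ 4 ≤ 6 * 4 ^ 4 := by gcongr
          _ ≤ 1536 := by norm_num
      · simp only [G]
        rw [Set.indicator_of_mem (by simpa using hsh.2)]
        gcongr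
        rcases hab z hsh.1 hsh.2 with h' | h'
        · have := norm_weight_sq_le_profile hs h'
          linarith [profile_nonneg ((√s / 128) • (z - b))]
        · have := norm_weight_sq_le_profile hs h'
          linarith [profile_nonneg ((√s / 128) • (z - a))]
    · have h0 : χ z = 0 := Function.notMem_support.1 fun h' => hsh (h h')
      have h1 : dz χ z = 0 := Function.notMem_support.1 fun h' => hsh (support_dz_subset h h')
      have h2 : dz (dz χ) z = 0 := Function.notMem_support.1 fun h' =>
        hsh (support_dz_subset (support_dz_subset h) h')
      rw [h0, h1, h2]
      simp only [amplitude, mul_zero, add_zero, sub_zero, norm_zero]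
      refine mul_nonneg hK0 (add_nonneg (add_nonneg (profile_nonneg _) (profile_nonneg _)) ?_)
      exact Set.indicator_nonneg (fun _ _ => (inv_pos.2 hs).le) z
  rw [heq]
  refine (norm_integral_le_of_norm_le hGi ?_).trans ?_
  · filter_upwards [Measure.ae_ne volume (0 : ℂ)] with z hz using hbound z hz
  · simp only [G]
    rw [integral_const_mul, integral_add hab_i hi, integral_add (integrable_profile_comp hR a)
      (integrable_profile_comp hR b), integral_profile_comp, integral_profile_comp, hR2,
      integral_indicator Metric.isClosed_closedBall.measurableSet, setIntegral_const, smul_eq_mul]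
    have := inv_pos.2 hs
    calc _ = K * (2 * 128 ^ 2 * Q + V) * s⁻¹ := by ring
      _ ≤ _ := by nlinarith

end Cutoff

/-! ### Transfer to the plane and scaling of the kernel. -/

/-- The identification of the Euclidean plane with `ℂ`. -/
noncomputable def toComplex : Plane ≃ₗᵢ[ℝ] ℂ := Complex.orthonormalBasisOneI.repr.symm

theorem toComplex_apply (ξ : Plane) : toComplex ξ = ξ 0 + ξ 1 * Complex.I :=
  Complex.orthonormalBasisOneI_repr_symm_apply ξ

theorem inner_eq_re (x ξ : Plane) :
    inner ℝ x ξ = ((starRingEnd ℂ) (toComplex x) * toComplex ξ).re := by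
  rw [← toComplex.inner_map_map x ξ, Complex.inner, mul_comm]

theorem apply_zero_div_norm_sq (ξ : Plane) : ξ 0 / ‖ξ‖ ^ 2 = ((toComplex ξ)⁻¹).re := by
  rw [Complex.inv_re, Complex.normSq_eq_norm_sq, toComplex.norm_map, toComplex_apply]
  simp

/-- The multiplier `e^{i x·ξ - i t ξ₁ / |ξ|²}`. -/
noncomputable def wave (t : ℝ) (x ξ : Plane) : ℂ :=
  Complex.exp (Complex.I * ((inner ℝ x ξ : ℝ) : ℂ)
    - Complex.I * ((t * (ξ 0 / ‖ξ‖ ^ 2) : ℝ) : ℂ))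

theorem wave_eq_osc {t R : ℝ} (ht : 0 < t) (hR : 0 < R) (x ξ : Plane) :
    wave t x ξ = osc (t * R) ((starRingEnd ℂ) (toComplex x) / (t * R ^ 2 : ℝ))
      (toComplex (R • ξ)) := by
  have hR' : (R : ℂ) ≠ 0 := by exact_mod_cast hR.ne'
  have ht' : (t : ℂ) ≠ 0 := by exact_mod_cast ht.ne'
  rw [wave, osc, ← mul_sub, ← Complex.ofReal_sub, inner_eq_re, apply_zero_div_norm_sq]
  congr 3
  rw [← Complex.re_ofReal_mul, ← Complex.re_ofReal_mul, ← Complex.sub_re]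
  congr 1
  rw [map_smul, Complex.real_smul, mul_inv]
  push_cast
  field_simp

theorem norm_wave (t : ℝ) (x ξ : Plane) : ‖wave t x ξ‖ = 1 := by
  rw [wave, ← mul_sub, ← Complex.ofReal_sub, mul_comm, Complex.norm_exp_ofReal_mul_I]

theorem measurable_wave (t : ℝ) (x : Plane) : Measurable (wave t x) := by
  unfold wave
  have h1 : Measurable fun ξ : Plane => ξ 0 := by fun_prop
  have h2 : Measurable fun ξ : Plane => (inner ℝ x ξ : ℝ) :=
    (continuous_const.inner continuous_id).measurable
  fun_prop

theorem exp_mul_wave (t : ℝ) (x y ξ : Plane) :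
    Complex.exp (-Complex.I * ((inner ℝ y ξ : ℝ) : ℂ)) * wave t x ξ = wave t (x - y) ξ := by
  rw [wave, wave, ← Complex.exp_add, inner_sub_left]
  congr 1
  push_cast
  ring

theorem integral_comp_smul_plane (F : Plane → ℂ) {R : ℝ} (hR : 0 < R) :
    ∫ ξ, F (R • ξ) = ((R : ℂ) ^ 2)⁻¹ * ∫ ξ, F ξ := by
  rw [Measure.integral_comp_smul volume F R, finrank_euclideanSpace_fin,
    abs_of_nonneg (by positivity), Complex.real_smul]
  push_cast
  rfl

/-- Dispersive decay of the frequency localised kernels. -/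
theorem exists_norm_kernel_le {χ : ℂ → ℂ} (hχ : ContDiff ℝ ∞ χ)
    (h : Function.support χ ⊆ {z | 1 / 4 ≤ ‖z‖ ∧ ‖z‖ ≤ 4}) :
    ∃ C : ℝ, 0 < C ∧ ∀ t : ℝ, 0 < t → ∀ R : ℝ, 0 < R → ∀ x : Plane,
      ‖∫ ξ, wave t x ξ * χ (toComplex (R • ξ))‖ ≤ C * t⁻¹ * R⁻¹ ^ 3 := by
  obtain ⟨C, hC, hb⟩ := exists_norm_integral_osc_le hχ h
  refine ⟨C, hC, fun t ht R hR x => ?_⟩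
  set w : ℂ := (starRingEnd ℂ) (toComplex x) / (t * R ^ 2 : ℝ)
  have e1 : ∫ ξ, wave t x ξ * χ (toComplex (R • ξ)) =
      ((R : ℂ) ^ 2)⁻¹ * ∫ η, osc (t * R) w (toComplex η) * χ (toComplex η) := by
    rw [← integral_comp_smul_plane (fun η => osc (t * R) w (toComplex η) * χ (toComplex η)) hR]
    refine integral_congr_ae (Filter.Eventually.of_forall fun ξ => ?_)
    simp only [wave_eq_osc ht hR, w]
  have e2 : ∫ η, osc (t * R) w (toComplex η) * χ (toComplex η) =
      ∫ z, osc (t * R) w z * χ z :=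
    toComplex.measurePreserving.integral_comp toComplex.toHomeomorph.measurableEmbedding
      (fun z => osc (t * R) w z * χ z)
  rw [e1, e2, norm_mul, norm_inv, norm_pow, Complex.norm_real,
    Real.norm_of_nonneg hR.le]
  calc (R ^ 2)⁻¹ * ‖∫ z, osc (t * R) w z * χ z‖ ≤ (R ^ 2)⁻¹ * (C * (t * R)⁻¹) := by
        gcongr
        exact hb _ (by positivity) w
    _ = C * t⁻¹ * R⁻¹ ^ 3 := by
        rw [mul_inv]
        ring

/-- A smooth cutoff equal to one on the shell `1/2 ≤ |z| ≤ 2`. -/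
theorem exists_shell_cutoff : ∃ χ : ℂ → ℂ, ContDiff ℝ ∞ χ ∧
    Function.support χ ⊆ {z | 1 / 4 ≤ ‖z‖ ∧ ‖z‖ ≤ 4} ∧
    ∀ z, 1 / 2 ≤ ‖z‖ → ‖z‖ ≤ 2 → χ z = 1 := by
  let f : ContDiffBump (0 : ℂ) := ⟨2, 4, by norm_num, by norm_num⟩
  let g : ContDiffBump (0 : ℂ) := ⟨1 / 4, 1 / 2, by norm_num, by norm_num⟩
  refine ⟨fun z => ((f z * (1 - g z) : ℝ) : ℂ), ?_, ?_, ?_⟩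
  · exact Complex.ofRealCLM.contDiff.comp (f.contDiff.mul (contDiff_const.sub g.contDiff))
  · intro z hz
    have hz' : f z * (1 - g z) ≠ 0 := by
      intro h0
      exact hz (by simp [h0])
    constructor
    · by_contra hn
      apply hz'
      rw [g.one_of_mem_closedBall (by simpa [g] using (not_le.1 hn).le)]
      simp
    · by_contra hn
      apply hz'
      rw [f.zero_of_le_dist (by simpa [f] using (not_le.1 hn).le)]
      simp
  · intro z h1 h2
    simp only
    rw [f.one_of_mem_closedBall (by simpa [f] using h2),
      g.zero_of_le_dist (by simpa [g] using h1)]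
    simp

/-! ### Fourier duality in the normalisation of `fourierHat`. -/

section Fourier

open FourierTransform

theorem fourierInv_eq (h : Plane → ℂ) (x : Plane) :
    fourierInv h x = (2 * Real.pi : ℂ) ^ 2 * 𝓕⁻ (fun η => h ((2 * Real.pi) • η)) x := by
  have hpi : (Real.pi : ℂ) ≠ 0 := by exact_mod_cast Real.pi_pos.ne'
  have e := integral_comp_smul_plane
    (fun ξ : Plane => Complex.exp (Complex.I * ((inner ℝ x ξ : ℝ) : ℂ)) * h ξ) Real.two_pi_pos
  have e' : 𝓕⁻ (fun η => h ((2 * Real.pi) • η)) x =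
      ((2 * Real.pi : ℂ) ^ 2)⁻¹ * fourierInv h x := by
    rw [Real.fourierInv_eq', fourierInv]
    push_cast at e
    rw [← e]
    refine integral_congr_ae (Filter.Eventually.of_forall fun η => ?_)
    simp only [smul_eq_mul, inner_smul_right, real_inner_comm]
    congr 2
    push_cast
    ring
  rw [e']
  field_simp

theorem fourier_comp_smul_eq (m : Plane → ℂ) (y : Plane) :
    𝓕 (fun η => m ((2 * Real.pi) • η)) y = ((2 * Real.pi : ℂ) ^ 2)⁻¹ *
      ∫ ξ, Complex.exp (-Complex.I * ((inner ℝ y ξ : ℝ) : ℂ)) * m ξ := by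
  have e := integral_comp_smul_plane
    (fun ξ : Plane => Complex.exp (-Complex.I * ((inner ℝ y ξ : ℝ) : ℂ)) * m ξ) Real.two_pi_pos
  rw [Real.fourier_eq']
  push_cast at e
  rw [← e]
  refine integral_congr_ae (Filter.Eventually.of_forall fun η => ?_)
  simp only [smul_eq_mul, inner_smul_right, real_inner_comm]
  congr 2
  push_cast
  ring

theorem fourierHat_eq (g : Plane → ℂ) (ξ : Plane) :
    fourierHat g ξ = ((2 * Real.pi : ℂ) ^ 2)⁻¹ * 𝓕 g ((2 * Real.pi)⁻¹ • ξ) := by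
  have hpi : (Real.pi : ℂ) ≠ 0 := by exact_mod_cast Real.pi_pos.ne'
  rw [fourierHat, Real.fourier_eq']
  congr 1
  refine integral_congr_ae (Filter.Eventually.of_forall fun η => ?_)
  simp only [smul_eq_mul, inner_smul_right]
  congr 2
  push_cast
  field_simp

theorem continuous_fourierHat {g : Plane → ℂ} (hg : ContDiff ℝ ∞ g) (hc : HasCompactSupport g) :
    Continuous (fourierHat g) := by
  have h : Continuous (𝓕 g) := by
    have := (𝓕 (hc.toSchwartzMap hg)).continuous
    rwa [SchwartzMap.fourier_coe] at this
  rw [funext (fourierHat_eq g)]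
  fun_prop

theorem integrable_fourierHat {g : Plane → ℂ} (hg : ContDiff ℝ ∞ g) (hc : HasCompactSupport g) :
    Integrable (fourierHat g) := by
  have h : Integrable (𝓕 g) := by
    have := (𝓕 (hc.toSchwartzMap hg)).integrable (μ := volume)
    rwa [SchwartzMap.fourier_coe] at this
  rw [funext (fourierHat_eq g)]
  exact (h.comp_smul (by positivity)).const_mul _

theorem continuous_fourierInv {h : Plane → ℂ} (hi : Integrable h) :
    Continuous (fourierInv h) := by
  rw [funext (fourierInv_eq h)]
  have h1 : Integrable fun η : Plane => h ((2 * Real.pi) • η) := hi.comp_smul (by positivity)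
  have h2 : Continuous (𝓕⁻ fun η : Plane => h ((2 * Real.pi) • η)) := by
    rw [Real.fourierInv_eq_fourier_comp_neg]
    exact VectorFourier.fourierIntegral_continuous Real.continuous_fourierChar
      (by exact continuous_inner) h1.comp_neg
  fun_prop

/-- A frequency-side pairing is bounded by the supremum of the kernel of the multiplier times the
`L¹` norm of the inverse Fourier transform. -/
theorem norm_integral_mul_le {m h : Plane → ℂ} {B : ℝ} (hm : Integrable m) (hc : Continuous h)
    (hh : Integrable h) (hP : Integrable (fourierInv h))
    (hB : ∀ y, ‖∫ ξ, Complex.exp (-Complex.I * ((inner ℝ y ξ : ℝ) : ℂ)) * m ξ‖ ≤ B) :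
    ‖∫ ξ, m ξ * h ξ‖ ≤ B * ∫ y, ‖fourierInv h y‖ := by
  have hpi : (Real.pi : ℂ) ≠ 0 := by exact_mod_cast Real.pi_pos.ne'
  have hc2 : ((2 * Real.pi : ℂ) ^ 2) ≠ 0 := by simp [hpi]
  set h' : Plane → ℂ := fun η => h ((2 * Real.pi) • η) with hh'
  set m' : Plane → ℂ := fun η => m ((2 * Real.pi) • η) with hm'
  have hi' : Integrable h' := hh.comp_smul (by positivity)
  have hmi' : Integrable m' := hm.comp_smul (by positivity)
  have hinv : 𝓕⁻ h' = fun x => ((2 * Real.pi : ℂ) ^ 2)⁻¹ * fourierInv h x := by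
    funext x
    rw [fourierInv_eq]
    field_simp
    rfl
  have hinvi : Integrable (𝓕⁻ h') := by
    rw [hinv]
    exact hP.const_mul _
  -- The two transforms differ by a reflection, so integrability of `fourierInv h` is what licenses
  -- Fourier inversion.
  have hfi : Integrable (𝓕 h') := by
    refine hinvi.comp_neg.congr (Filter.Eventually.of_forall fun x => ?_)
    simp [Real.fourierInv_eq_fourier_neg]
  have hinversion : 𝓕 (𝓕⁻ h') = h' :=
    Continuous.fourier_fourierInv_eq (by fun_prop) hi' hfi
  have hflip : ∫ ξ, 𝓕 (𝓕⁻ h') ξ • m' ξ = ∫ y, 𝓕⁻ h' y • 𝓕 m' y := by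
    have := VectorFourier.integral_fourierIntegral_smul_eq_flip (μ := (volume : Measure Plane))
      (ν := (volume : Measure Plane)) (L := innerₗ Plane) Real.continuous_fourierChar
      (by exact continuous_inner) hinvi hmi'
    rw [flip_innerₗ] at this
    exact this
  have hscale : ∫ ξ, m ξ * h ξ = (2 * Real.pi : ℂ) ^ 2 * ∫ ξ, h' ξ * m' ξ := by
    have e := integral_comp_smul_plane (fun ξ => h ξ * m ξ) Real.two_pi_pos
    simp only [hh', hm']
    push_cast at e
    rw [e, mul_inv_cancel_left₀ hc2]
    simp only [mul_comm]
  rw [hinversion] at hflip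
  simp only [smul_eq_mul] at hflip
  rw [hscale, hflip, hinv, ← integral_const_mul, ← integral_const_mul]
  refine norm_integral_le_of_norm_le (hP.norm.const_mul B)
    (Filter.Eventually.of_forall fun y => ?_)
  rw [fourier_comp_smul_eq, mul_assoc, mul_inv_cancel_left₀ hc2, norm_mul, norm_mul, mul_comm]
  gcongr
  -- The factor `(2π)⁻² ≤ 1` is discarded.
  calc _ ≤ 1 * ‖∫ ξ, Complex.exp (-Complex.I * ((inner ℝ y ξ : ℝ) : ℂ)) * m ξ‖ := by
        gcongr
        rw [norm_inv, norm_pow]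
        refine inv_le_one_of_one_le₀ (one_le_pow₀ ?_)
        have : ‖(2 * Real.pi : ℂ)‖ = 2 * Real.pi := by
          rw [norm_mul, Complex.norm_real, Real.norm_of_nonneg Real.pi_pos.le]
          simp
        rw [this]
        linarith [Real.pi_gt_three]
    _ ≤ B := by rw [one_mul]; exact hB y

end Fourier

/-! ### Littlewood-Paley decomposition and summation. -/

variable {φ : Plane → ℝ} {g : Plane → ℂ}

/-- Only three dyadic dilates of the shell `1/2 ≤ |ξ| ≤ 2` meet at a given point. -/
theorem mem_Icc_of_shell {ξ : Plane} (hξ : ξ ≠ 0) {j : ℤ}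
    (h : 1 / 2 ≤ ‖(2 : ℝ) ^ (-j) • ξ‖ ∧ ‖(2 : ℝ) ^ (-j) • ξ‖ ≤ 2) :
    j ∈ Finset.Icc (Int.log 2 ‖ξ‖ - 1) (Int.log 2 ‖ξ‖ + 1) := by
  have hn : 0 < ‖ξ‖ := norm_pos_iff.2 hξ
  have h1 : (2 : ℝ) ^ Int.log 2 ‖ξ‖ ≤ ‖ξ‖ := by
    exact_mod_cast Int.zpow_log_le_self (b := 2) (by norm_num) hn
  have h2 : ‖ξ‖ < (2 : ℝ) ^ (Int.log 2 ‖ξ‖ + 1) := by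
    exact_mod_cast Int.lt_zpow_succ_log_self (b := 2) (by norm_num) ‖ξ‖
  have hj : (0 : ℝ) < 2 ^ j := by positivity
  rw [norm_smul, Real.norm_of_nonneg (by positivity), zpow_neg, inv_mul_eq_div,
    le_div_iff₀ hj, div_le_iff₀ hj] at h
  have h3 : (2 : ℝ) ^ (j - 1) < 2 ^ (Int.log 2 ‖ξ‖ + 1) := by
    rw [zpow_sub_one₀ (by norm_num)]
    linarith [h.1]
  have h4 : (2 : ℝ) ^ Int.log 2 ‖ξ‖ ≤ 2 ^ (j + 1) := by
    rw [zpow_add_one₀ (by norm_num)]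
    linarith [h.2]
  have h5 := (zpow_lt_zpow_iff_right₀ (by norm_num : (1 : ℝ) < 2)).1 h3
  have h6 := (zpow_le_zpow_iff_right₀ (by norm_num : (1 : ℝ) < 2)).1 h4
  rw [Finset.mem_Icc]
  omega

namespace IsLittlewoodPaleyBump

theorem hasCompactSupport (hφ : IsLittlewoodPaleyBump φ) : HasCompactSupport φ := by
  refine HasCompactSupport.intro (isCompact_closedBall (0 : Plane) 2) fun ξ hξ => ?_
  by_contra hn
  exact hξ (by simpa using (hφ.support_subset hn).2)

theorem hasCompactSupport_dilate (hφ : IsLittlewoodPaleyBump φ) (j : ℤ) :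
    HasCompactSupport fun ξ : Plane => ((φ ((2 : ℝ) ^ (-j) • ξ) : ℝ) : ℂ) :=
  (hφ.hasCompactSupport.comp_smul (c := (2 : ℝ) ^ (-j)) (by positivity)).comp_left
    (g := Complex.ofReal) rfl

theorem continuous_dilate (hφ : IsLittlewoodPaleyBump φ) (j : ℤ) :
    Continuous fun ξ : Plane => ((φ ((2 : ℝ) ^ (-j) • ξ) : ℝ) : ℂ) := by
  have := hφ.smooth.continuous
  fun_prop

theorem tsum_enorm_dilate_le (hφ : IsLittlewoodPaleyBump φ) :
    ∃ M : ℝ≥0∞, M ≠ ⊤ ∧ ∀ ξ : Plane, ξ ≠ 0 →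
    ∑' j : ℤ, ‖((φ ((2 : ℝ) ^ (-j) • ξ) : ℝ) : ℂ)‖ₑ ≤ M := by
  obtain ⟨A, hA⟩ := hφ.hasCompactSupport.exists_bound_of_continuous hφ.smooth.continuous
  refine ⟨3 * ENNReal.ofReal A, by finiteness, fun ξ hξ => ?_⟩
  rw [tsum_eq_sum (s := Finset.Icc (Int.log 2 ‖ξ‖ - 1) (Int.log 2 ‖ξ‖ + 1))]
  · refine (Finset.sum_le_card_nsmul _ _ (ENNReal.ofReal A) fun j _ => ?_).trans ?_
    · rw [← ofReal_norm, Complex.norm_real]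
      exact ENNReal.ofReal_le_ofReal (hA _)
    · rw [Int.card_Icc, nsmul_eq_mul]
      gcongr
      have : (Int.log 2 ‖ξ‖ + 1 + 1 - (Int.log 2 ‖ξ‖ - 1)).toNat = 3 := by
        ring_nf
        rfl
      rw [this]
      norm_num
  · intro j hj
    have : φ ((2 : ℝ) ^ (-j) • ξ) = 0 := by
      by_contra hn
      exact hj (mem_Icc_of_shell hξ (hφ.support_subset hn))
    rw [this, Complex.ofReal_zero, enorm_zero]

/-- Littlewood-Paley decomposition of the semigroup. -/
theorem semigroup_eq_tsum (hφ : IsLittlewoodPaleyBump φ) (hg : ContDiff ℝ ∞ g)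
    (hc : HasCompactSupport g) (t : ℝ) (x : Plane) :
    semigroup t g x = ∑' j : ℤ, ∫ ξ, wave t x ξ *
      (((φ ((2 : ℝ) ^ (-j) • ξ) : ℝ) : ℂ) * fourierHat g ξ) := by
  obtain ⟨M, hM, hb⟩ := hφ.tsum_enorm_dilate_le
  have hgi := integrable_fourierHat hg hc
  have hmeas : ∀ j : ℤ, AEStronglyMeasurable (fun ξ => wave t x ξ *
      (((φ ((2 : ℝ) ^ (-j) • ξ) : ℝ) : ℂ) * fourierHat g ξ)) volume := fun j =>
    (measurable_wave t x).aestronglyMeasurable.mul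
      ((hφ.continuous_dilate j).aestronglyMeasurable.mul hgi.aestronglyMeasurable)
  rw [← integral_tsum hmeas]
  · refine integral_congr_ae ?_
    filter_upwards [Measure.ae_ne volume (0 : Plane)] with ξ hξ
    have h1 : HasSum (fun j : ℤ => ((φ ((2 : ℝ) ^ (-j) • ξ) : ℝ) : ℂ)) ((1 : ℝ) : ℂ) :=
      Complex.hasSum_ofReal.2 (hφ.hasSum_one ξ hξ)
    have h2 := ((h1.mul_right (fourierHat g ξ)).mul_left (wave t x ξ)).tsum_eq
    rw [h2, Complex.ofReal_one, one_mul, wave]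
  · rw [← lintegral_tsum fun j => (hmeas j).enorm]
    -- Bounded overlap of the shells and integrability of `fourierHat g` justify exchanging sum and
    -- integral.
    refine ne_top_of_le_ne_top (b := ∫⁻ ξ, M * ‖fourierHat g ξ‖ₑ) ?_ (lintegral_mono_ae ?_)
    · rw [lintegral_const_mul' _ _ hM]
      exact ENNReal.mul_ne_top hM hgi.hasFiniteIntegral.ne
    · filter_upwards [Measure.ae_ne volume (0 : Plane)] with ξ hξ
      have hw : ‖wave t x ξ‖ₑ = 1 := by rw [← ofReal_norm, norm_wave, ENNReal.ofReal_one]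
      simp only [enorm_mul, hw, one_mul, ENNReal.tsum_mul_right]
      gcongr
      exact hb ξ hξ

/-- Dispersive decay of each dyadic piece. -/
theorem exists_enorm_dyadic_le (hφ : IsLittlewoodPaleyBump φ) :
    ∃ C : ℝ, 0 < C ∧ ∀ g : Plane → ℂ, ContDiff ℝ ∞ g → HasCompactSupport g →
      ∀ t : ℝ, 0 < t → ∀ (x : Plane) (j : ℤ),
      ‖∫ ξ, wave t x ξ * (((φ ((2 : ℝ) ^ (-j) • ξ) : ℝ) : ℂ) * fourierHat g ξ)‖ₑ ≤
        ENNReal.ofReal (C * t⁻¹ * ((2 : ℝ) ^ j) ^ 3) * eLpNorm (lpProj φ j g) 1 volume := by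
  obtain ⟨χ, hχ, hs, h1⟩ := exists_shell_cutoff
  obtain ⟨C, hC, hb⟩ := exists_norm_kernel_le hχ hs
  refine ⟨C, hC, fun g hg hc t ht x j => ?_⟩
  set R : ℝ := (2 : ℝ) ^ (-j) with hR
  have hR0 : 0 < R := by positivity
  have hRj : (2 : ℝ) ^ j = R⁻¹ := by rw [hR, zpow_neg, inv_inv]
  set h : Plane → ℂ := fun ξ => ((φ (R • ξ) : ℝ) : ℂ) * fourierHat g ξ with hh
  have hcont : Continuous h := (hφ.continuous_dilate j).mul (continuous_fourierHat hg hc)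
  have hint : Integrable h :=
    hcont.integrable_of_hasCompactSupport (hφ.hasCompactSupport_dilate j).mul_right
  have hPj : lpProj φ j g = fourierInv h := rfl
  have hpos : 0 < C * t⁻¹ * ((2 : ℝ) ^ j) ^ 3 := by positivity
  -- If the `L¹` norm is infinite, the right side is `⊤` since its coefficient is positive.
  by_cases htop : eLpNorm (lpProj φ j g) 1 volume = ⊤
  · rw [htop, ENNReal.mul_top (ENNReal.ofReal_pos.2 hpos).ne']
    exact le_top
  have hP : Integrable (fourierInv h) := by
    rw [← memLp_one_iff_integrable]
    exact ⟨(continuous_fourierInv hint).aestronglyMeasurable, lt_top_iff_ne_top.2 htop⟩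
  have hχi : Integrable fun ξ : Plane => χ (toComplex (R • ξ)) := by
    have h2 : Integrable χ :=
      hχ.continuous.integrable_of_hasCompactSupport (hasCompactSupport_of_shell hs)
    exact (toComplex.measurePreserving.integrable_comp_of_integrable h2).comp_smul hR0.ne'
  have hmi : Integrable fun ξ => wave t x ξ * χ (toComplex (R • ξ)) :=
    hχi.bdd_mul (c := 1) (measurable_wave t x).aestronglyMeasurable
      (Filter.Eventually.of_forall fun ξ => (norm_wave t x ξ).le)
  -- The wider cutoff `χ` equals `1` on the support of the dilated `φ`; it localises the kernel and
  -- leaves `P_j g` intact as the other factor.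
  have heq : ∀ ξ, wave t x ξ * h ξ = wave t x ξ * χ (toComplex (R • ξ)) * h ξ := by
    intro ξ
    by_cases hz : φ (R • ξ) = 0
    · simp [hh, hz]
    · have h3 := hφ.support_subset hz
      rw [h1 _ (by rw [toComplex.norm_map]; exact h3.1) (by rw [toComplex.norm_map]; exact h3.2),
        mul_one]
  -- The character `e^{-i y·ξ}` merely translates `x` to `x - y`, and the kernel bound is uniform in
  -- that point.
  have hmain := norm_integral_mul_le hmi hcont hint hP (B := C * t⁻¹ * R⁻¹ ^ 3) fun y => by
    simp only [← mul_assoc, exp_mul_wave]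
    exact hb t ht R hR0 (x - y)
  calc ‖∫ ξ, wave t x ξ * h ξ‖ₑ
      = ENNReal.ofReal ‖∫ ξ, wave t x ξ * χ (toComplex (R • ξ)) * h ξ‖ := by
        rw [ofReal_norm, integral_congr_ae (Filter.Eventually.of_forall heq)]
    _ ≤ ENNReal.ofReal (C * t⁻¹ * R⁻¹ ^ 3 * ∫ y, ‖fourierInv h y‖) :=
        ENNReal.ofReal_le_ofReal hmain
    _ = _ := by
        rw [hRj] at hpos
        rw [ENNReal.ofReal_mul hpos.le, ofReal_integral_norm_eq_lintegral_enorm hP, hRj, hPj,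
          eLpNorm_one_eq_lintegral_enorm]

end IsLittlewoodPaleyBump

theorem besovNorm_three_one_one (φ : Plane → ℝ) (g : Plane → ℂ) :
    besovNorm φ 3 1 1 g =
      ∑' j : ℤ, ENNReal.ofReal (((2 : ℝ) ^ j) ^ 3) * eLpNorm (lpProj φ j g) 1 volume := by
  rw [besovNorm, eLpNorm_one_eq_lintegral_enorm, lintegral_count]
  refine tsum_congr fun j => ?_
  rw [enorm_eq_self]
  congr 1
  have h2 : (2 : ℝ≥0∞) = ENNReal.ofReal 2 := by simp
  rw [h2, ENNReal.ofReal_rpow_of_pos two_pos, mul_comm, Real.rpow_mul two_pos.le,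
    Real.rpow_intCast]
  norm_cast

end BetaPlane

theorem proposition5p1 (φ : BetaPlane.Plane → ℝ) (hφ : BetaPlane.IsLittlewoodPaleyBump φ) :
    ∃ C : ℝ, 0 < C ∧ ∀ g : BetaPlane.Plane → ℂ, ContDiff ℝ ∞ g → HasCompactSupport g →
      ∀ t : ℝ, 0 < t →
        eLpNorm (BetaPlane.semigroup t g) ∞ volume
          ≤ ENNReal.ofReal (C * t⁻¹) * BetaPlane.besovNorm φ 3 1 1 g := by
  obtain ⟨C, hC, hb⟩ := hφ.exists_enorm_dyadic_le
  refine ⟨C, hC, fun g hg hc t ht => ?_⟩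
  rw [eLpNorm_exponent_top, BetaPlane.besovNorm_three_one_one, ← ENNReal.tsum_mul_left]
  refine eLpNormEssSup_le_of_ae_enorm_bound (Filter.Eventually.of_forall fun x => ?_)
  rw [hφ.semigroup_eq_tsum hg hc t x]
  refine enorm_tsum_le_tsum_enorm.trans (ENNReal.tsum_le_tsum fun j => ?_)
  rw [← mul_assoc, ← ENNReal.ofReal_mul (by positivity)]
  exact hb g hg hc t ht x j
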